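/- Let $G$ be a group with a finite generating set $S$. Suppose that $G$ has an infinite normal subgroup $H$ such that $(G,H)$ has relative Property (T): for every orthogonal representation $\pi$ of $G$ on a real Hilbert space and every sequence $(v_n)$ of unit vectors with $\|\pi(g)v_n-v_n\|\to 0$ for all $g\in G$, one has $\sup_{h\in H}\|\pi(h)v_n-v_n\|\to 0$. Let $N_0\supseteq N_1\supseteq N_2\supseteq\cdots$ be a nested sequence of finite index normal subgroups of $G$ with $\bigcap_{n} N_n=\{e\}$, and let $d_n$ be the distance on $G/N_n$ given by its Cayley graph with respect to the image of $S$. Then the box space $(G/N_n,d_n)_{n\in\mathbb N}$ does not coarsely embed into any uniformly curved (real or complex) Banach space $X$; that is, there do not exist maps $\phi_n\colon G/N_n\to X$ and proper functions $\rho,\gamma\colon[0,\infty)\to[0,\infty)$ (i.e. functions tending to infinity at infinity), independent of $n$, with $$\rho(d_n(x,y))\le \|\phi_n(x)-\phi_n(y)\|\le\gamma(d_n(x,y))\qquad\text{for all } n \text{ and all } x,y\in G/N_n.$$ Here a Banach space $X$ is *uniformly curved* if there is a function $\varepsilon\mapsto\Delta_X(\varepsilon)$, tending to $0$ as $\varepsilon\to0^+$,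 such that for every $\varepsilon>0$ and every measure space $(\Omega,\mu)$, every operator $T\colon L^2(\Omega,\mu)\to L^2(\Omega,\mu)$ (over the scalar field of $X$) with $\|T\|\le\varepsilon$ which is simultaneously of norm $\le 1$ on $L^1(\Omega,\mu)$ and on $L^\infty(\Omega,\mu)$ extends to an operator $T\otimes\mathrm{id}_X$ of norm $\le\Delta_X(\varepsilon)$ on $L^2(\Omega,\mu;X)$. -/

import Mathlib

open Filter Topology MeasureTheory
open scoped ENNReal NNReal

universe u v

/-- A sequence `v` of unit vectors is almost invariant under the orthogonal representation `π` if
`‖π g (v n) - v n‖ → 0` for every group element `g`. -/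
def IsAlmostInvariant {G : Type u} [Group G] {E : Type v} [NormedAddCommGroup E]
    [InnerProductSpace ℝ E] (π : G →* (E ≃ₗᵢ[ℝ] E)) (v : ℕ → E) : Prop :=
  (∀ n, ‖v n‖ = 1) ∧ ∀ g : G, Tendsto (fun n => ‖π g (v n) - v n‖) atTop (𝓝 0)

/-- The pair `(G, Y)` has relative Property (T): for every orthogonal representation of `G` on a
real Hilbert space and every almost invariant sequence `v` of unit vectors,
`‖π y (v n) - v n‖ → 0` uniformly in `y ∈ Y`.

Hilbert spaces in the universe of `G` suffice: an almost invariant sequence lives in the closed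
subrepresentation it generates, which has a dense subset of cardinality at most `max |G| ℵ₀`. -/
def HasRelativePropertyT (G : Type u) [Group G] (Y : Set G) : Prop :=
  ∀ (E : Type u) [NormedAddCommGroup E] [InnerProductSpace ℝ E] [CompleteSpace E]
    (π : G →* (E ≃ₗᵢ[ℝ] E)) (v : ℕ → E), IsAlmostInvariant π v →
      TendstoUniformlyOn (fun n y => ‖π y (v n) - v n‖) (fun _ => 0) atTop Y

/-- A Banach space `X` over `𝕜` (`ℝ` or `ℂ`) is uniformly curved if there is a function `Δ` with
`Δ ε → 0` as `ε → 0⁺` such that for every measure space `(Ω, μ)`, every operator `T` on `L²(μ)`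
of norm at most `ε` which is simultaneously of norm at most `1` on `L¹(μ)` and on `L^∞(μ)` extends
to an operator `T ⊗ id_X` of norm at most `Δ ε` on `L²(μ; X)`.

The norms on `L¹` and `L^∞` are tested on `L² ∩ L¹` and on `L² ∩ L^∞` (the inequalities are void
when the right-hand side is infinite). The operator `TX` is `T ⊗ id_X`: it sends `f(·) x` to
`(T f)(·) x` for all `f ∈ L²(μ)` and `x ∈ X`, which determines it because the span of such
functions is dense. Measure spaces in `Type` suffice: by approximation by simple functions and
conditional expectations, the condition over arbitrary measure spaces is equivalent to the
one over finite ones. -/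
def IsUniformlyCurved (𝕜 : Type*) [RCLike 𝕜] (X : Type*) [NormedAddCommGroup X]
    [NormedSpace 𝕜 X] : Prop :=
  ∃ Δ : ℝ → ℝ, Tendsto Δ (𝓝[>] 0) (𝓝 0) ∧
    ∀ ε : ℝ, 0 < ε → ∀ (Ω : Type) [MeasurableSpace Ω] (μ : Measure Ω)
      (T : Lp 𝕜 2 μ →L[𝕜] Lp 𝕜 2 μ), ‖T‖ ≤ ε →
      (∀ f : Lp 𝕜 2 μ, eLpNorm (T f) 1 μ ≤ eLpNorm f 1 μ) →
      (∀ f : Lp 𝕜 2 μ, eLpNorm (T f) ∞ μ ≤ eLpNorm f ∞ μ) →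
      ∃ TX : Lp X 2 μ →L[𝕜] Lp X 2 μ,
        (∀ (f : Lp 𝕜 2 μ) (x : X),
          TX ((ContinuousLinearMap.toSpanSingleton 𝕜 x).compLp f) =
            (ContinuousLinearMap.toSpanSingleton 𝕜 x).compLp (T f)) ∧
        ‖TX‖ ≤ Δ ε

/-- The sequence `(W n, d n)` of metric spaces coarsely embeds into the metric space `Y`: there are
maps `φ n : W n → Y` and two proper functions `ρ, γ : [0, ∞) → [0, ∞)` (that is, functions tending
to infinity at infinity), independent of `n`, with
`ρ (d n x y) ≤ dist (φ n x) (φ n y) ≤ γ (d n x y)` for all `n`, `x`, `y`. -/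
def SeqCoarselyEmbeds {W : ℕ → Type*} (d : ∀ n, W n → W n → ℝ≥0) (Y : Type*)
    [PseudoMetricSpace Y] : Prop :=
  ∃ (φ : ∀ n, W n → Y) (ρ γ : ℝ≥0 → ℝ≥0), Tendsto ρ atTop atTop ∧ Tendsto γ atTop atTop ∧
    ∀ n (x y : W n), ρ (d n x y) ≤ nndist (φ n x) (φ n y) ∧
      nndist (φ n x) (φ n y) ≤ γ (d n x y)

/-- The metrics of the box space of `G` associated to a generating set `S` and a sequence `N` of
normal subgroups: on `G ⧸ N n`, the graph distance of the Cayley graph with respect to the image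
of `S` (edges join `x` to `x * s` for `s` in the image of `S`). -/
noncomputable def boxDist {G : Type*} [Group G] (S : Set G) (N : ℕ → Subgroup G)
    [∀ n, (N n).Normal] (n : ℕ) (x y : G ⧸ N n) : ℝ≥0 :=
  ((SimpleGraph.mulCayley ((QuotientGroup.mk' (N n)) '' S)).dist x y : ℕ)

open scoped Matrix.Module

set_option linter.unusedSectionVars false

/-! Write `Q = G ⧸ N n`, let `K` be the image of `H`, and let elements of `Q` act on functions on
`Q` by right translation. The plan is to bound the `ℓ²` displacement by all of `K` of a function `F
: Q → X` by a constant times its displacement by the generators, uniformly in `n`.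

Relative Property (T) gives one Kazhdan constant for all the regular representations
(`HasRelativePropertyT.exists_isKazhdanPair`). Hence the lazy Markov operator `A` contracts the
kernel of the `K`-average `P` in scalar `ℓ²` by a factor `c < 1` independent of `n`
(`countNorm_lazyMarkov_smul_le`). The operator `A ^ k * (1 - P) / 2` is then a contraction on `ℓ¹`
and `ℓ^∞`, with `ℓ²` norm at most `c ^ k`. Uniform curvature turns this into a small norm on
`X`-valued `ℓ²` for one fixed `k`. Since `A ^ k` moves `(1 - P) • F` by a multiple of the generator
displacement while shrinking it by half, `(1 - P) • F` is itself small; it carries all the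
displacement by `K` (`IsUniformlyCurved.exists_displacement_bound`).

For a coarse embedding, the generators move `φ n` by a bounded amount at every point. As `H` is
infinite, some element of it is far from `1` in a deep quotient, so it moves `φ n` by an arbitrarily
large amount at every point, a contradiction. -/

/-- The `ℓ^p` norm of a vector-valued function on a finite set. -/
noncomputable def countNorm {Ω V : Type*} [MeasurableSpace Ω] [NormedAddCommGroup V] (p : ℝ≥0∞)
    (F : Ω → V) : ℝ :=
  (eLpNorm F p Measure.count).toReal

/-! ### Norms for the counting measure on a finite set. -/

section countNorm

variable {Ω Ω' V W : Type*} [Fintype Ω] [MeasurableSpace Ω] [MeasurableSingletonClass Ω]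
  [Fintype Ω'] [MeasurableSpace Ω'] [MeasurableSingletonClass Ω']
  [NormedAddCommGroup V] [NormedAddCommGroup W] {p : ℝ≥0∞}

theorem eLpNorm_count_ne_top (F : Ω → V) : eLpNorm F p Measure.count ≠ ∞ :=
  (eLpNorm_count_lt_top_of_lt fun _ => by simp).ne

theorem aestronglyMeasurable_count (F : Ω → V) : AEStronglyMeasurable F Measure.count :=
  (StronglyMeasurable.of_discrete (f := F)).aestronglyMeasurable

theorem memLp_count (F : Ω → V) : MemLp F p Measure.count :=
  ⟨aestronglyMeasurable_count F, (eLpNorm_count_ne_top F).lt_top⟩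

theorem countNorm_nonneg (F : Ω → V) : 0 ≤ countNorm p F := ENNReal.toReal_nonneg

theorem eLpNorm_count_le_iff (F : Ω → V) (F' : Ω' → W) :
    eLpNorm F p Measure.count ≤ eLpNorm F' p Measure.count ↔ countNorm p F ≤ countNorm p F' :=
  (ENNReal.toReal_le_toReal (eLpNorm_count_ne_top F) (eLpNorm_count_ne_top F')).symm

theorem countNorm_add_le [Fact (1 ≤ p)] (F F' : Ω → V) :
    countNorm p (F + F') ≤ countNorm p F + countNorm p F' := by
  unfold countNorm
  rw [← ENNReal.toReal_add (eLpNorm_count_ne_top F) (eLpNorm_count_ne_top F')]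
  exact ENNReal.toReal_mono
    (ENNReal.add_ne_top.2 ⟨eLpNorm_count_ne_top F, eLpNorm_count_ne_top F'⟩)
    (eLpNorm_add_le (aestronglyMeasurable_count F) (aestronglyMeasurable_count F') Fact.out)

theorem countNorm_neg (F : Ω → V) : countNorm p (-F) = countNorm p F := by
  simp [countNorm, eLpNorm_neg]

theorem countNorm_sub_le [Fact (1 ≤ p)] (F F' : Ω → V) :
    countNorm p (F - F') ≤ countNorm p F + countNorm p F' := by
  rw [sub_eq_add_neg, ← countNorm_neg F']
  exact countNorm_add_le _ _

theorem countNorm_zero : countNorm p (0 : Ω → V) = 0 := by simp [countNorm]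

theorem countNorm_smul [NormedSpace ℝ V] (c : ℝ) (F : Ω → V) :
    countNorm p (c • F) = |c| * countNorm p F := by
  simp [countNorm, eLpNorm_const_smul, ENNReal.toReal_mul]

theorem countNorm_sum_le [Fact (1 ≤ p)] {ι : Type*} (s : Finset ι) (F : ι → Ω → V) :
    countNorm p (∑ i ∈ s, F i) ≤ ∑ i ∈ s, countNorm p (F i) :=
  Finset.le_sum_of_subadditive _ countNorm_zero.le countNorm_add_le s F

theorem countNorm_comp_equiv (e : Ω' ≃ Ω) (F : Ω → V) : countNorm p (F ∘ e) = countNorm p F := by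
  have h : MeasurePreserving e Measure.count Measure.count := by
    refine ⟨measurable_of_finite _, ?_⟩
    ext s hs
    rw [Measure.map_apply (measurable_of_finite _) hs, Measure.count_apply hs,
      Measure.count_apply (measurable_of_finite e hs)]
    congr 1
    exact Set.encard_preimage_of_bijective e.bijective s
  rw [countNorm, eLpNorm_comp_measurePreserving (aestronglyMeasurable_count F) h, countNorm]

theorem countNorm_two_sq (F : Ω → V) : countNorm 2 F ^ 2 = ∑ x, ‖F x‖ ^ 2 := by
  have h : (eLpNorm F 2 Measure.count) ^ 2 = ∑ x, ‖F x‖ₑ ^ 2 := by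
    rw [eLpNorm_eq_lintegral_rpow_enorm_toReal (by simp) (by simp), ← ENNReal.rpow_natCast,
      ← ENNReal.rpow_mul]
    simp [lintegral_count, tsum_fintype]
  rw [countNorm, ← ENNReal.toReal_pow, h, ENNReal.toReal_sum (by simp)]
  simp

theorem countNorm_two_eq_sqrt (F : Ω → V) : countNorm 2 F = √(∑ x, ‖F x‖ ^ 2) := by
  rw [← countNorm_two_sq, Real.sqrt_sq (countNorm_nonneg F)]

end countNorm

/-! ### Uniform curvature for real matrices on finite sets. -/

section UniformlyCurved

variable {𝕜 X : Type*} [RCLike 𝕜] [NormedAddCommGroup X] [NormedSpace 𝕜 X] [NormedSpace ℝ X]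
  [IsScalarTower ℝ 𝕜 X]

/-- The continuous operator on `L²` of a finite set defined by a real matrix. -/
noncomputable def matrixLp (𝕜 : Type*) [RCLike 𝕜] {Ω : Type*} [Fintype Ω] [DecidableEq Ω]
    [MeasurableSpace Ω] [MeasurableSingletonClass Ω] (M : Matrix Ω Ω ℝ) {C : ℝ}
    (hM : ∀ f : Ω → 𝕜, countNorm 2 (M • f) ≤ C * countNorm 2 f) :
    Lp 𝕜 2 (Measure.count : Measure Ω) →L[𝕜] Lp 𝕜 2 (Measure.count : Measure Ω) :=
  LinearMap.mkContinuous
    { toFun := fun f => (memLp_count (M • (f : Ω → 𝕜))).toLp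
      map_add' := fun f g => by
        rw [← MemLp.toLp_add]
        congr 1
        have : ((f + g : Lp 𝕜 2 (Measure.count : Measure Ω)) : Ω → 𝕜) = f + g :=
          funext (Measure.ae_count_iff.1 (Lp.coeFn_add f g))
        rw [this, smul_add]
      map_smul' := fun c f => by
        rw [RingHom.id_apply, ← MemLp.toLp_const_smul]
        congr 1
        have : ((c • f : Lp 𝕜 2 (Measure.count : Measure Ω)) : Ω → 𝕜) = c • ⇑f :=
          funext (Measure.ae_count_iff.1 (Lp.coeFn_smul c f))
        rw [this]
        ext x
        simp [Matrix.Module.smul_apply, Finset.mul_sum] }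
    C fun f => by
      rw [LinearMap.coe_mk, AddHom.coe_mk, Lp.norm_toLp, Lp.norm_def]
      exact hM f

theorem matrixLp_apply {Ω : Type*} [Fintype Ω] [DecidableEq Ω]
    [MeasurableSpace Ω] [MeasurableSingletonClass Ω] (M : Matrix Ω Ω ℝ) {C : ℝ}
    (hM : ∀ f : Ω → 𝕜, countNorm 2 (M • f) ≤ C * countNorm 2 f)
    (f : Lp 𝕜 2 (Measure.count : Measure Ω)) : (matrixLp 𝕜 M hM f : Ω → 𝕜) = M • (f : Ω → 𝕜) :=
  funext (Measure.ae_count_iff.1 (MemLp.coeFn_toLp (memLp_count (M • (f : Ω → 𝕜)))))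

theorem coeFn_toLp_count {Ω V : Type*} [Fintype Ω] [NormedAddCommGroup V]
    [MeasurableSpace Ω] [MeasurableSingletonClass Ω] (f : Ω → V) :
    ((memLp_count (p := 2) f).toLp : Ω → V) = f :=
  funext (Measure.ae_count_iff.1 (MemLp.coeFn_toLp (memLp_count f)))

theorem coeFn_compLp_toSpanSingleton {Ω : Type*} [Fintype Ω]
    [MeasurableSpace Ω] [MeasurableSingletonClass Ω] (x : X)
    (f : Lp 𝕜 2 (Measure.count : Measure Ω)) :
    ((ContinuousLinearMap.toSpanSingleton 𝕜 x).compLp f : Ω → X) = fun a => f a • x :=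
  funext (Measure.ae_count_iff.1 (ContinuousLinearMap.coeFn_compLp _ f))

/-- In a uniformly curved space, a matrix which is contractive on scalar `ℓ¹` and `ℓ^∞` and has
small norm on scalar `ℓ²` has small norm on vector-valued `ℓ²`. -/
theorem IsUniformlyCurved.exists_countNorm_le_of_type (hX : IsUniformlyCurved 𝕜 X) :
    ∃ Δ : ℝ → ℝ, Tendsto Δ (𝓝[>] 0) (𝓝 0) ∧
      ∀ ε : ℝ, 0 < ε → ∀ (Ω : Type) [Fintype Ω] [DecidableEq Ω] [MeasurableSpace Ω]
        [MeasurableSingletonClass Ω] (M : Matrix Ω Ω ℝ),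
        (∀ f : Ω → 𝕜, countNorm 2 (M • f) ≤ ε * countNorm 2 f) →
        (∀ f : Ω → 𝕜, countNorm 1 (M • f) ≤ countNorm 1 f) →
        (∀ f : Ω → 𝕜, countNorm ∞ (M • f) ≤ countNorm ∞ f) →
        ∀ F : Ω → X, countNorm 2 (M • F) ≤ Δ ε * countNorm 2 F := by
  obtain ⟨Δ, hΔ, h⟩ := hX
  refine ⟨Δ, hΔ, fun ε hε Ω _ _ _ _ M h2 h1 hinf F => ?_⟩
  obtain ⟨TX, hTX, hnorm⟩ := h ε hε Ω Measure.count (matrixLp 𝕜 M h2)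
    (LinearMap.mkContinuous_norm_le _ hε.le _)
    (fun f => by
      rw [matrixLp_apply]
      exact (eLpNorm_count_le_iff _ _).2 (h1 f))
    (fun f => by
      rw [matrixLp_apply]
      exact (eLpNorm_count_le_iff _ _).2 (hinf f))
  -- `TX` is prescribed only on elementary tensors; on a finite set every `F` is a finite sum of
  -- them, one for each point mass.
  have key : TX (memLp_count F).toLp = (memLp_count (M • F)).toLp := by
    have hF : (memLp_count (p := 2) F).toLp = ∑ y, (ContinuousLinearMap.toSpanSingleton 𝕜 (F y)).compLp
        (memLp_count (p := 2) (Pi.single y (1 : 𝕜))).toLp := by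
      apply Lp.ext
      refine Measure.ae_count_iff.2 fun x => ?_
      rw [coeFn_toLp_count]
      have := Measure.ae_count_iff.1 (Lp.coeFn_finsetSum Finset.univ (fun y =>
        (ContinuousLinearMap.toSpanSingleton 𝕜 (F y)).compLp
          (memLp_count (p := 2) (Pi.single y (1 : 𝕜))).toLp)) x
      rw [this, Finset.sum_apply]
      simp only [coeFn_compLp_toSpanSingleton, coeFn_toLp_count]
      simp [Pi.single_apply]
    rw [hF, map_sum]
    simp only [hTX]
    apply Lp.ext
    refine Measure.ae_count_iff.2 fun x => ?_
    rw [coeFn_toLp_count]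
    have := Measure.ae_count_iff.1 (Lp.coeFn_finsetSum Finset.univ (fun y =>
      (ContinuousLinearMap.toSpanSingleton 𝕜 (F y)).compLp (matrixLp 𝕜 M h2
        (memLp_count (p := 2) (Pi.single y (1 : 𝕜))).toLp))) x
    rw [this, Finset.sum_apply]
    simp only [coeFn_compLp_toSpanSingleton, matrixLp_apply, coeFn_toLp_count]
    simp [Pi.single_apply]
  have := (TX.le_of_opNorm_le hnorm) (memLp_count F).toLp
  rwa [key, Lp.norm_toLp, Lp.norm_toLp] at this

theorem reindex_smul_comp {Ω Ω' V : Type*} [Fintype Ω] [DecidableEq Ω] [Fintype Ω']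
    [DecidableEq Ω'] [NormedAddCommGroup V] [NormedSpace ℝ V] (e : Ω ≃ Ω') (M : Matrix Ω Ω ℝ)
    (F : Ω' → V) : (Matrix.reindex e e M • F) ∘ e = M • (F ∘ e) := by
  ext x
  simp only [Function.comp_apply, Matrix.Module.smul_apply, Matrix.reindex_apply,
    Matrix.submatrix_apply, Equiv.symm_apply_apply]
  exact (Fintype.sum_equiv e _ _ (by simp)).symm

/-- Uniform curvature is tested on measure spaces in `Type`; relabelling the points by `Fin` frees
the finite set from that universe. -/
theorem IsUniformlyCurved.exists_countNorm_le (hX : IsUniformlyCurved 𝕜 X) :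
    ∃ Δ : ℝ → ℝ, Tendsto Δ (𝓝[>] 0) (𝓝 0) ∧
      ∀ ε : ℝ, 0 < ε → ∀ (Ω : Type u) [Fintype Ω] [DecidableEq Ω] [MeasurableSpace Ω]
        [MeasurableSingletonClass Ω] (M : Matrix Ω Ω ℝ),
        (∀ f : Ω → 𝕜, countNorm 2 (M • f) ≤ ε * countNorm 2 f) →
        (∀ f : Ω → 𝕜, countNorm 1 (M • f) ≤ countNorm 1 f) →
        (∀ f : Ω → 𝕜, countNorm ∞ (M • f) ≤ countNorm ∞ f) →
        ∀ F : Ω → X, countNorm 2 (M • F) ≤ Δ ε * countNorm 2 F := by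
  obtain ⟨Δ, hΔ, h⟩ := hX.exists_countNorm_le_of_type
  refine ⟨Δ, hΔ, fun ε hε Ω _ _ _ _ M h2 h1 hinf F => ?_⟩
  let e := Fintype.equivFin Ω
  have tr (p : ℝ≥0∞) {V : Type _} [NormedAddCommGroup V] [NormedSpace ℝ V] (f : Fin _ → V) :
      countNorm p (Matrix.reindex e e M • f) = countNorm p (M • (f ∘ e)) := by
    rw [← countNorm_comp_equiv e, reindex_smul_comp]
  have := h ε hε (Fin (Fintype.card Ω)) (Matrix.reindex e e M)
    (fun f => by rw [tr, ← countNorm_comp_equiv e f]; exact h2 _)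
    (fun f => by rw [tr, ← countNorm_comp_equiv e f]; exact h1 _)
    (fun f => by rw [tr, ← countNorm_comp_equiv e f]; exact hinf _) (F ∘ e.symm)
  rw [← countNorm_comp_equiv e, reindex_smul_comp, countNorm_comp_equiv e.symm] at this
  simpa [Function.comp_assoc] using this

end UniformlyCurved

/-! ### Hilbert sums of representations and uniformity in relative Property (T). -/

section DirectSum

variable {ι : Type*} {E : ι → Type*} [∀ i, NormedAddCommGroup (E i)]
  [∀ i, InnerProductSpace ℝ (E i)]

/-- Coordinatewise application of linear isometries on a Hilbert sum. -/
noncomputable def lpMapIsometryEquiv (e : ∀ i, E i ≃ₗᵢ[ℝ] E i) : lp E 2 ≃ₗᵢ[ℝ] lp E 2 where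
  toFun f := ⟨fun i => e i (f i), by
    have := lp.memℓp f
    rw [← memℓp_norm_iff] at this
    refine memℓp_norm_iff.1 (?_ : Memℓp (fun i => ‖e i (f i)‖) 2)
    simpa using this⟩
  invFun f := ⟨fun i => (e i).symm (f i), by
    have := lp.memℓp f
    rw [← memℓp_norm_iff] at this
    refine memℓp_norm_iff.1 (?_ : Memℓp (fun i => ‖(e i).symm (f i)‖) 2)
    simpa using this⟩
  map_add' f g := lp.ext (funext fun i => (e i).map_add _ _)
  map_smul' c f := lp.ext (funext fun i => (e i).map_smul _ _)
  left_inv f := lp.ext (funext fun i => (e i).symm_apply_apply _)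
  right_inv f := lp.ext (funext fun i => (e i).apply_symm_apply _)
  norm_map' f := by
    rw [lp.norm_eq_tsum_rpow (by simp), lp.norm_eq_tsum_rpow (by simp)]
    congr 1
    exact tsum_congr fun i => congrArg (· ^ _) ((e i).norm_map _)

theorem lpMapIsometryEquiv_apply (e : ∀ i, E i ≃ₗᵢ[ℝ] E i) (f : lp E 2) (i : ι) :
    lpMapIsometryEquiv e f i = e i (f i) := rfl

/-- The Hilbert sum of a family of orthogonal representations. -/
noncomputable def lpRep {G : Type*} [Group G] (π : ∀ i, G →* (E i ≃ₗᵢ[ℝ] E i)) :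
    G →* (lp E 2 ≃ₗᵢ[ℝ] lp E 2) where
  toFun g := lpMapIsometryEquiv fun i => π i g
  map_one' := by
    ext f i
    simp [lpMapIsometryEquiv_apply]
  map_mul' g h := by
    ext f i
    simp [lpMapIsometryEquiv_apply]

theorem lpRep_single [DecidableEq ι] {G : Type*} [Group G] (π : ∀ i, G →* (E i ≃ₗᵢ[ℝ] E i)) (g : G)
    (i : ι) (v : E i) : lpRep π g (lp.single 2 i v) = lp.single 2 i (π i g v) := by
  ext j
  change π j g (lp.single 2 i v j) = _
  rcases eq_or_ne j i with rfl | h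
  · rw [lp.single_apply_self, lp.single_apply_self]
  · rw [lp.single_apply_ne _ _ _ h, lp.single_apply_ne _ _ _ h, map_zero]

end DirectSum

/-- Displacement is subadditive under products and unchanged under inverses, so almost invariance
need only be checked on generators. -/
theorem tendsto_norm_sub_of_closure {G E : Type*} [Group G] [NormedAddCommGroup E]
    [InnerProductSpace ℝ E] (π : G →* (E ≃ₗᵢ[ℝ] E)) {S : Set G} (hS : Subgroup.closure S = ⊤)
    {v : ℕ → E} (hv : ∀ s ∈ S, Tendsto (fun n => ‖π s (v n) - v n‖) atTop (𝓝 0)) (g : G) :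
    Tendsto (fun n => ‖π g (v n) - v n‖) atTop (𝓝 0) := by
  have hg : g ∈ Subgroup.closure S := hS ▸ Subgroup.mem_top g
  induction hg using Subgroup.closure_induction with
  | mem s hs => exact hv s hs
  | one => simp
  | mul x y _ _ hx hy =>
    refine squeeze_zero (fun _ => norm_nonneg _) (fun n => ?_) (by simpa using hy.add hx)
    calc ‖π (x * y) (v n) - v n‖ = ‖π x (π y (v n) - v n) + (π x (v n) - v n)‖ := by
          simp [map_sub]
      _ ≤ _ := (norm_add_le _ _).trans (by rw [LinearIsometryEquiv.norm_map])
  | inv x _ hx =>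
    refine hx.congr fun n => ?_
    have h : π x⁻¹ (π x (v n)) = v n := by
      change (π x⁻¹ * π x) (v n) = v n
      rw [← map_mul, inv_mul_cancel, map_one]
      rfl
    rw [← (π x⁻¹).norm_map (π x (v n) - v n), norm_sub_rev, map_sub, h]

/-- Relative Property (T) is uniform over families of orthogonal representations. -/
theorem HasRelativePropertyT.exists_uniform {G : Type u} [Group G] {Y S : Set G}
    (hT : HasRelativePropertyT G Y) (hS : Subgroup.closure S = ⊤) {ι : Type*} (E : ι → Type u)
    [∀ i, NormedAddCommGroup (E i)] [∀ i, InnerProductSpace ℝ (E i)] [∀ i, CompleteSpace (E i)]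
    (π : ∀ i, G →* (E i ≃ₗᵢ[ℝ] E i)) {δ : ℝ} (hδ : 0 < δ) :
    ∃ ε > 0, ∀ i (v : E i), (∀ s ∈ S, ‖π i s v - v‖ ≤ ε * ‖v‖) →
      ∀ y ∈ Y, ‖π i y v - v‖ ≤ δ * ‖v‖ := by
  by_contra! hcon
  choose i v hv y hy hlt using fun n : ℕ => hcon (1 / ((n : ℝ) + 1)) (by positivity)
  have hv0 (n) : v n ≠ 0 := by
    intro h
    have := hlt n
    simp [h] at this
  -- Each counterexample is normalized and placed in its own summand, so that together they form one
  -- almost invariant sequence in a single representation.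
  let w (n : ℕ) : lp (fun n => E (i n)) 2 := lp.single 2 n (‖v n‖⁻¹ • v n)
  have hw (g : G) (n : ℕ) : ‖lpRep (fun n => π (i n)) g (w n) - w n‖ =
      ‖v n‖⁻¹ * ‖π (i n) g (v n) - v n‖ := by
    simp only [w]
    rw [lpRep_single, ← lp.single_sub, lp.norm_single (by simp), map_smul, ← smul_sub, norm_smul]
    simp
  have hinv : IsAlmostInvariant (lpRep fun n => π (i n)) w := by
    refine ⟨fun n => ?_, tendsto_norm_sub_of_closure _ hS fun s hs => ?_⟩
    · simp only [w]
      rw [lp.norm_single (by simp), norm_smul, norm_inv, norm_norm,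
        inv_mul_cancel₀ (norm_ne_zero_iff.2 (hv0 n))]
    · refine squeeze_zero (fun _ => norm_nonneg _) (fun n => ?_)
        tendsto_one_div_add_atTop_nhds_zero_nat
      rw [hw, inv_mul_le_iff₀ (norm_pos_iff.2 (hv0 n)), mul_comm]
      exact hv n s hs
  have := Metric.tendstoUniformlyOn_iff.1 (hT _ _ _ hinv) δ hδ
  obtain ⟨n, hn⟩ := this.exists
  have := hn (y n) (hy n)
  rw [hw, dist_zero_left, Real.norm_of_nonneg (by positivity),
    inv_mul_lt_iff₀ (norm_pos_iff.2 (hv0 n)), mul_comm] at this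
  exact lt_asymm this (hlt n)

/-! ### Averages of translations on a finite group and the spectral gap. -/

section Averages

variable {Q V ι : Type*} [Group Q] [Fintype Q] [DecidableEq Q] [NormedAddCommGroup V]
  [NormedSpace ℝ V]

/-- The matrix of right translation by `g`. -/
def translationMatrix (g : Q) : Matrix Q Q ℝ := fun x y => if x * g = y then 1 else 0

theorem translationMatrix_smul (g : Q) (F : Q → V) :
    translationMatrix g • F = F ∘ Equiv.mulRight g := by
  ext x
  simp [translationMatrix]

theorem translationMatrix_one : translationMatrix (1 : Q) = 1 := by
  ext x y
  simp [translationMatrix, Matrix.one_apply]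

theorem translationMatrix_mul (g h : Q) :
    translationMatrix g * translationMatrix h = translationMatrix (g * h) := by
  ext x y
  rw [Matrix.mul_apply, Finset.sum_eq_single (x * g)] <;>
    simp +contextual [translationMatrix, mul_assoc, eq_comm]

/-- The average of the right translations by the elements `q i` for `i ∈ s`. -/
noncomputable def averageMatrix (s : Finset ι) (q : ι → Q) : Matrix Q Q ℝ :=
  (s.card : ℝ)⁻¹ • ∑ i ∈ s, translationMatrix (q i)

theorem averageMatrix_smul (s : Finset ι) (q : ι → Q) (F : Q → V) :
    averageMatrix s q • F = (s.card : ℝ)⁻¹ • ∑ i ∈ s, translationMatrix (q i) • F := by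
  rw [averageMatrix, smul_assoc, Finset.sum_smul]

theorem averageMatrix_smul_sub {s : Finset ι} (hs : s.Nonempty) (q : ι → Q) (F : Q → V) :
    averageMatrix s q • F - F = (s.card : ℝ)⁻¹ • ∑ i ∈ s, (translationMatrix (q i) • F - F) := by
  have : (s.card : ℝ) ≠ 0 := by simpa using hs.ne_empty
  rw [averageMatrix_smul, Finset.sum_sub_distrib, smul_sub, Finset.sum_const,
    ← Nat.cast_smul_eq_nsmul ℝ, smul_smul, inv_mul_cancel₀ this, one_smul]

/-- The average of the right translations by the elements of a subgroup. -/
noncomputable def subgroupAverage (K : Subgroup Q) [Fintype K] : Matrix Q Q ℝ :=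
  averageMatrix (Finset.univ : Finset K) Subtype.val

theorem translationMatrix_mul_subgroupAverage (K : Subgroup Q) [Fintype K] {h : Q} (hh : h ∈ K) :
    translationMatrix h * subgroupAverage K = subgroupAverage K := by
  rw [subgroupAverage, averageMatrix, mul_smul_comm, Finset.mul_sum]
  congr 1
  simp only [translationMatrix_mul]
  exact Fintype.sum_equiv (Equiv.mulLeft (⟨h, hh⟩ : K)) _ _ fun _ => rfl

theorem subgroupAverage_mul_self (K : Subgroup Q) [Fintype K] :
    subgroupAverage K * subgroupAverage K = subgroupAverage K := by
  have h0 : (Fintype.card K : ℝ) ≠ 0 := by simp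
  conv_lhs => enter [1]; rw [subgroupAverage, averageMatrix]
  rw [smul_mul_assoc, Finset.sum_mul, Finset.sum_congr rfl fun h _ =>
    translationMatrix_mul_subgroupAverage K h.2, Finset.sum_const, Finset.card_univ,
    ← Nat.cast_smul_eq_nsmul ℝ, smul_smul, inv_mul_cancel₀ h0, one_smul]

/-- Conjugation by `g` permutes the normal subgroup `K`, hence the terms of the average. -/
theorem commute_translationMatrix_subgroupAverage (K : Subgroup Q) [Fintype K] [K.Normal] (g : Q) :
    Commute (translationMatrix g) (subgroupAverage K) := by
  rw [Commute, SemiconjBy, subgroupAverage, averageMatrix, mul_smul_comm, smul_mul_assoc,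
    Finset.mul_sum, Finset.sum_mul]
  congr 1
  simp only [translationMatrix_mul]
  exact Fintype.sum_equiv (MulAut.conjNormal g).toEquiv _ _ fun _ => by simp

theorem commute_averageMatrix_subgroupAverage (K : Subgroup Q) [Fintype K] [K.Normal]
    (s : Finset ι) (q : ι → Q) : Commute (averageMatrix s q) (subgroupAverage K) :=
  (Commute.sum_left _ _ _ fun _ _ => commute_translationMatrix_subgroupAverage K _).smul_left _

variable [MeasurableSpace Q] [MeasurableSingletonClass Q] {p : ℝ≥0∞}

theorem countNorm_translationMatrix_smul (g : Q) (F : Q → V) :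
    countNorm p (translationMatrix g • F) = countNorm p F := by
  rw [translationMatrix_smul, countNorm_comp_equiv]

theorem countNorm_averageMatrix_smul_le [Fact (1 ≤ p)] (s : Finset ι) (q : ι → Q) (F : Q → V) :
    countNorm p (averageMatrix s q • F) ≤ countNorm p F := by
  rw [averageMatrix_smul, countNorm_smul, abs_of_nonneg (by positivity)]
  have := countNorm_sum_le (p := p) s fun i => translationMatrix (q i) • F
  simp only [countNorm_translationMatrix_smul, Finset.sum_const, nsmul_eq_mul] at this
  rcases s.eq_empty_or_nonempty with rfl | hs
  · simpa using countNorm_nonneg F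
  · rwa [inv_mul_le_iff₀ (by exact_mod_cast hs.card_pos)]

theorem countNorm_averageMatrix_smul_sub_le [Fact (1 ≤ p)] {s : Finset ι} (hs : s.Nonempty)
    {q : ι → Q} {F : Q → V} {L : ℝ} (h : ∀ i ∈ s, countNorm p (translationMatrix (q i) • F - F) ≤ L) :
    countNorm p (averageMatrix s q • F - F) ≤ L := by
  rw [averageMatrix_smul_sub hs, countNorm_smul, abs_of_nonneg (by positivity),
    inv_mul_le_iff₀ (by exact_mod_cast hs.card_pos)]
  refine (countNorm_sum_le _ _).trans ((Finset.sum_le_sum h).trans ?_)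
  simp

theorem countNorm_averageMatrix_pow_smul_le [Fact (1 ≤ p)] (s : Finset ι) (q : ι → Q) (k : ℕ)
    (F : Q → V) : countNorm p (averageMatrix s q ^ k • F) ≤ countNorm p F := by
  induction k with
  | zero => simp
  | succ k ih =>
    rw [pow_succ', mul_smul]
    exact (countNorm_averageMatrix_smul_le _ _ _).trans ih

/-- Telescoping: each further power adds at most one single-step displacement, because the average
is a contraction. -/
theorem countNorm_averageMatrix_pow_smul_sub_le [Fact (1 ≤ p)] (s : Finset ι) (q : ι → Q) (k : ℕ)
    (F : Q → V) : countNorm p (averageMatrix s q ^ k • F - F) ≤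
      k * countNorm p (averageMatrix s q • F - F) := by
  induction k with
  | zero => simp [countNorm_zero]
  | succ k ih =>
    have : averageMatrix s q ^ (k + 1) • F - F =
        averageMatrix s q ^ k • (averageMatrix s q • F - F) + (averageMatrix s q ^ k • F - F) := by
      rw [pow_succ, mul_smul, smul_sub]
      abel
    rw [this]
    refine (countNorm_add_le _ _).trans ?_
    push_cast
    linarith [countNorm_averageMatrix_pow_smul_le (p := p) s q k (averageMatrix s q • F - F)]

theorem countNorm_one_sub_subgroupAverage_smul_le [Fact (1 ≤ p)] (K : Subgroup Q) [Fintype K]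
    (F : Q → V) : countNorm p ((1 - subgroupAverage K) • F) ≤ 2 * countNorm p F := by
  rw [sub_smul, one_smul, two_mul]
  exact (countNorm_sub_le _ _).trans
    (add_le_add_right (countNorm_averageMatrix_smul_le Finset.univ Subtype.val F) _)

theorem countNorm_two_parallelogram {Ω : Type*} [Fintype Ω] [MeasurableSpace Ω]
    [MeasurableSingletonClass Ω] (f g : Ω → ℝ) :
    countNorm 2 (f + g) ^ 2 + countNorm 2 (f - g) ^ 2 =
      2 * (countNorm 2 f ^ 2 + countNorm 2 g ^ 2) := by
  simp only [countNorm_two_sq, ← Finset.sum_add_distrib, Finset.mul_sum, Pi.add_apply,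
    Pi.sub_apply, Real.norm_eq_abs, sq_abs]
  exact Finset.sum_congr rfl fun x _ => by ring

/-- A real matrix acts separately on real and imaginary parts. This carries the gap from real
functions, where the Kazhdan condition lives, to `𝕜`-valued ones. -/
theorem countNorm_two_smul_le_of_real {Ω : Type*} [Fintype Ω] [DecidableEq Ω] [MeasurableSpace Ω]
    [MeasurableSingletonClass Ω] {𝕜 : Type*} [RCLike 𝕜] {M : Matrix Ω Ω ℝ} {C : ℝ} (hC : 0 ≤ C)
    (hM : ∀ f : Ω → ℝ, countNorm 2 (M • f) ≤ C * countNorm 2 f) (f : Ω → 𝕜) :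
    countNorm 2 (M • f) ≤ C * countNorm 2 f := by
  have key (f : Ω → 𝕜) : countNorm 2 f ^ 2 =
      countNorm 2 (fun x => RCLike.re (f x)) ^ 2 + countNorm 2 (fun x => RCLike.im (f x)) ^ 2 := by
    simp only [countNorm_two_sq, ← Finset.sum_add_distrib]
    refine Finset.sum_congr rfl fun x _ => ?_
    rw [RCLike.norm_sq_eq_def, Real.norm_eq_abs, Real.norm_eq_abs, sq_abs, sq_abs]
    ring
  have hre : (fun x => RCLike.re ((M • f) x)) = M • fun x => RCLike.re (f x) := by
    ext x
    simp [RCLike.smul_re]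
  have him : (fun x => RCLike.im ((M • f) x)) = M • fun x => RCLike.im (f x) := by
    ext x
    simp [RCLike.smul_im]
  refine (sq_le_sq₀ (countNorm_nonneg _) (mul_nonneg hC (countNorm_nonneg f))).1 ?_
  rw [key, hre, him, mul_pow, key f, mul_add, ← mul_pow, ← mul_pow]
  exact add_le_add (pow_le_pow_left₀ (countNorm_nonneg _) (hM _) 2)
    (pow_le_pow_left₀ (countNorm_nonneg _) (hM _) 2)

/-- The pair of a finite family `q` and a subgroup `K` satisfies the Kazhdan condition with
constant `ε` for the regular representation. -/
def IsKazhdanPair (s : Finset ι) (q : ι → Q) (K : Subgroup Q) (ε : ℝ) : Prop :=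
  ∀ v : Q → ℝ, (∀ i ∈ s, countNorm 2 (translationMatrix (q i) • v - v) ≤ ε * countNorm 2 v) →
    ∀ h ∈ K, countNorm 2 (translationMatrix h • v - v) ≤ 1 / 2 * countNorm 2 v

/-- The lazy Markov operator associated to a finite family. -/
noncomputable def lazyMarkov (s : Finset ι) (q : ι → Q) : Matrix Q Q ℝ :=
  averageMatrix s.insertNone fun i => i.elim 1 q

/-- A nonzero `v` killed by the `K`-average is at distance `‖v‖` from that average, so it is not
almost invariant and some generator moves it by more than `ε * ‖v‖`. Laziness pairs that translate
with `v` itself, and uniform convexity makes their sum shorter. -/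
theorem countNorm_lazyMarkov_smul_le {s : Finset ι} {q : ι → Q} {K : Subgroup Q} [Fintype K]
    {ε : ℝ} (hε : 0 < ε) (hε1 : ε ≤ 1) (hK : IsKazhdanPair s q K ε) {v : Q → ℝ}
    (hv : subgroupAverage K • v = 0) :
    countNorm 2 (lazyMarkov s q • v) ≤ (1 - ε ^ 2 / (4 * (s.card + 1))) * countNorm 2 v := by
  by_cases h : ∀ i ∈ s, countNorm 2 (translationMatrix (q i) • v - v) ≤ ε * countNorm 2 v
  · have : countNorm 2 (subgroupAverage K • v - v) ≤ 1 / 2 * countNorm 2 v :=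
      countNorm_averageMatrix_smul_sub_le (Finset.univ_nonempty (α := K))
        (q := Subtype.val) fun h' _ => hK v h h'.1 h'.2
    rw [hv, zero_sub, countNorm_neg] at this
    have h0 : countNorm 2 v = 0 := by linarith [countNorm_nonneg (p := 2) v]
    rw [h0, mul_zero, ← h0, lazyMarkov]
    exact countNorm_averageMatrix_smul_le _ _ v
  · push Not at h
    obtain ⟨i, hi, hlt⟩ := h
    have hN := countNorm_nonneg (p := 2) v
    -- The parallelogram law bounds the square by `(4 - ε ^ 2) * ‖v‖ ^ 2`, and `4 - ε ^ 2 ≤ (2 - ε ^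
    -- 2 / 4) ^ 2`.
    have hmid : countNorm 2 (v + translationMatrix (q i) • v) ≤
        (2 - ε ^ 2 / 4) * countNorm 2 v := by
      have hpar := countNorm_two_parallelogram (translationMatrix (q i) • v) v
      rw [countNorm_translationMatrix_smul, add_comm _ v] at hpar
      have hsq : (ε * countNorm 2 v) ^ 2 ≤ countNorm 2 (translationMatrix (q i) • v - v) ^ 2 :=
        pow_le_pow_left₀ (by positivity) hlt.le 2
      refine (sq_le_sq₀ (countNorm_nonneg _) (mul_nonneg (by nlinarith) hN)).1 ?_
      have : 0 ≤ (ε ^ 2 / 4 * countNorm 2 v) ^ 2 := by positivity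
      nlinarith
    classical
    have hsum : countNorm 2 (∑ j ∈ s.erase i, translationMatrix (q j) • v) ≤
        (s.card - 1) * countNorm 2 v := by
      refine (countNorm_sum_le _ _).trans ?_
      simp only [countNorm_translationMatrix_smul, Finset.sum_const, nsmul_eq_mul,
        Finset.card_erase_of_mem hi]
      rw [Nat.cast_pred (Finset.card_pos.2 ⟨i, hi⟩)]
    have hdec : lazyMarkov s q • v = ((s.card : ℝ) + 1)⁻¹ •
        ((v + translationMatrix (q i) • v) + ∑ j ∈ s.erase i, translationMatrix (q j) • v) := by
      rw [lazyMarkov, averageMatrix_smul, Finset.card_insertNone, Finset.sum_insertNone, add_assoc,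
        Finset.add_sum_erase s (fun j => translationMatrix (q j) • v) hi]
      simp [translationMatrix_one]
    rw [hdec, countNorm_smul, abs_of_nonneg (by positivity), inv_mul_le_iff₀ (by positivity)]
    refine (countNorm_add_le _ _).trans ?_
    have : ((s.card : ℝ) + 1) * ((1 - ε ^ 2 / (4 * (s.card + 1))) * countNorm 2 v) =
        (s.card + 1 - ε ^ 2 / 4) * countNorm 2 v := by
      field_simp
    rw [this]
    linarith

/-- Normality of `K` makes the Markov operator commute with the `K`-average, so the kernel is
preserved and the contraction iterates. -/
theorem countNorm_lazyMarkov_pow_smul_le {s : Finset ι} {q : ι → Q} {K : Subgroup Q} [Fintype K]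
    [K.Normal] {ε : ℝ} (hε : 0 < ε) (hε1 : ε ≤ 1) (hK : IsKazhdanPair s q K ε) (k : ℕ)
    {v : Q → ℝ} (hv : subgroupAverage K • v = 0) :
    countNorm 2 (lazyMarkov s q ^ k • v) ≤
      (1 - ε ^ 2 / (4 * (s.card + 1))) ^ k * countNorm 2 v := by
  induction k with
  | zero => simp
  | succ k ih =>
    rw [pow_succ', mul_smul, pow_succ', mul_assoc]
    have hpos : 0 ≤ 1 - ε ^ 2 / (4 * ((s.card : ℝ) + 1)) := by
      rw [sub_nonneg, div_le_one (by positivity)]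
      nlinarith [(Nat.cast_nonneg s.card : (0 : ℝ) ≤ s.card)]
    refine (countNorm_lazyMarkov_smul_le hε hε1 hK ?_).trans (mul_le_mul_of_nonneg_left ih hpos)
    have hcomm : Commute (lazyMarkov s q ^ k) (subgroupAverage K) :=
      (commute_averageMatrix_subgroupAverage K _ _).pow_left k
    rw [← mul_smul, ← hcomm.eq, mul_smul, hv, smul_zero]

theorem half_lazyMarkov_smul (s : Finset ι) (q : ι → Q) (K : Subgroup Q) [Fintype K] (k : ℕ)
    (F : Q → V) : ((1 / 2 : ℝ) • (lazyMarkov s q ^ k * (1 - subgroupAverage K))) • F =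
      (1 / 2 : ℝ) • lazyMarkov s q ^ k • (1 - subgroupAverage K) • F := by
  rw [smul_assoc, mul_smul]

/-- The factor `1 / 2` offsets the bound `2` for `1 - subgroupAverage K`, giving the contraction on
`ℓ¹` and `ℓ^∞` that uniform curvature demands. -/
theorem countNorm_half_lazyMarkov_smul_le [Fact (1 ≤ p)] (s : Finset ι) (q : ι → Q)
    (K : Subgroup Q) [Fintype K] (k : ℕ) (F : Q → V) :
    countNorm p (((1 / 2 : ℝ) • (lazyMarkov s q ^ k * (1 - subgroupAverage K))) • F) ≤
      countNorm p F := by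
  rw [half_lazyMarkov_smul, countNorm_smul, abs_of_nonneg (by positivity)]
  have h : countNorm p (lazyMarkov s q ^ k • (1 - subgroupAverage K) • F) ≤
      countNorm p ((1 - subgroupAverage K) • F) := countNorm_averageMatrix_pow_smul_le _ _ k _
  linarith [countNorm_one_sub_subgroupAverage_smul_le (p := p) K F]

theorem countNorm_two_half_lazyMarkov_smul_le {s : Finset ι} {q : ι → Q} {K : Subgroup Q}
    [Fintype K] [K.Normal] {ε : ℝ} (hε : 0 < ε) (hε1 : ε ≤ 1) (hK : IsKazhdanPair s q K ε) (k : ℕ)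
    (v : Q → ℝ) :
    countNorm 2 (((1 / 2 : ℝ) • (lazyMarkov s q ^ k * (1 - subgroupAverage K))) • v) ≤
      (1 - ε ^ 2 / (4 * (s.card + 1))) ^ k * countNorm 2 v := by
  rw [half_lazyMarkov_smul, countNorm_smul, abs_of_nonneg (by positivity)]
  have h0 : subgroupAverage K • (1 - subgroupAverage K) • v = 0 := by
    rw [← mul_smul, mul_sub, mul_one, subgroupAverage_mul_self, sub_self, zero_smul]
  have hpos : 0 ≤ 1 - ε ^ 2 / (4 * ((s.card : ℝ) + 1)) := by
    rw [sub_nonneg, div_le_one (by positivity)]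
    nlinarith [(Nat.cast_nonneg s.card : (0 : ℝ) ≤ s.card)]
  have := countNorm_lazyMarkov_pow_smul_le hε hε1 hK k h0
  have h2 := mul_le_mul_of_nonneg_left (countNorm_one_sub_subgroupAverage_smul_le (p := 2) K v)
    (pow_nonneg hpos k)
  linarith

end Averages

/-! ### Displacement of vector-valued functions. -/

/-- Uniformly over all finite groups carrying a Kazhdan pair, a function with values in a uniformly
curved space which is displaced little by the generators is displaced little by the subgroup. -/
theorem IsUniformlyCurved.exists_displacement_bound {𝕜 X : Type*} [RCLike 𝕜] [NormedAddCommGroup X]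
    [NormedSpace 𝕜 X] [NormedSpace ℝ X] [IsScalarTower ℝ 𝕜 X] (hX : IsUniformlyCurved 𝕜 X)
    {ε : ℝ} (hε : 0 < ε) (hε1 : ε ≤ 1) (m : ℕ) :
    ∃ C : ℝ, 0 < C ∧ ∀ (Q : Type u) [Group Q] [Fintype Q] [DecidableEq Q] [MeasurableSpace Q]
      [MeasurableSingletonClass Q] (ι : Type v) (s : Finset ι) (q : ι → Q) (K : Subgroup Q)
      [K.Normal], s.card = m → IsKazhdanPair s q K ε → ∀ (F : Q → X) (L : ℝ), 0 ≤ L →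
      (∀ i ∈ s, countNorm 2 (translationMatrix (q i) • F - F) ≤ L) →
      ∀ h ∈ K, countNorm 2 (translationMatrix h • F - F) ≤ C * L := by
  obtain ⟨Δ, hΔ, hbound⟩ := hX.exists_countNorm_le
  set c : ℝ := 1 - ε ^ 2 / (4 * (m + 1)) with hc
  have hm : (0 : ℝ) ≤ m := Nat.cast_nonneg m
  have hc0 : 0 < c := by
    rw [hc, sub_pos, div_lt_one (by positivity)]
    nlinarith
  have hc1 : c < 1 := sub_lt_self _ (by positivity)
  have hlim : Tendsto (fun k : ℕ => Δ (c ^ k)) atTop (𝓝 0) :=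
    hΔ.comp (tendsto_nhdsWithin_iff.2 ⟨tendsto_pow_atTop_nhds_zero_of_lt_one hc0.le hc1,
      Eventually.of_forall fun k => pow_pos hc0 k⟩)
  -- With the factor `1 / 2` in the test operator, `1 / 4` here means that `A ^ k` at least halves
  -- `g = (1 - P) • F`.
  obtain ⟨k, hk⟩ := (hlim.eventually_lt_const (show (0 : ℝ) < 1 / 4 by norm_num)).exists
  -- The estimates give `8 * k`; the extra `1` keeps the constant positive when `k = 0`.
  refine ⟨8 * (k + 1), by positivity, fun Q _ _ _ _ _ ι s q K _ hs hK F L hL hF h hh => ?_⟩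
  classical
  subst hs
  let A := lazyMarkov s q
  let P := subgroupAverage K
  have hcontr := hbound (c ^ k) (pow_pos hc0 k) Q ((1 / 2 : ℝ) • (A ^ k * (1 - P)))
    (countNorm_two_smul_le_of_real (pow_nonneg hc0.le k)
      (countNorm_two_half_lazyMarkov_smul_le hε hε1 hK k))
    (countNorm_half_lazyMarkov_smul_le s q K k) (countNorm_half_lazyMarkov_smul_le s q K k)
    ((1 - P) • F)
  rw [half_lazyMarkov_smul, countNorm_smul, abs_of_nonneg (by positivity)] at hcontr
  -- The bound is applied to `g` rather than `F`, so that `‖g‖` stands on both sides and can be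
  -- absorbed; this needs `1 - P` idempotent.
  have hidem : (1 - subgroupAverage K) • (1 - P) • F = (1 - P) • F := by
    have : (1 - subgroupAverage K) * (1 - P) = 1 - P := by
      simp only [P]
      rw [sub_mul, one_mul, mul_sub, mul_one, subgroupAverage_mul_self, sub_self, sub_zero]
    rw [← mul_smul, this]
  rw [hidem] at hcontr
  set g := (1 - P) • F with hg
  have hAF : countNorm 2 (A • F - F) ≤ L := by
    refine countNorm_averageMatrix_smul_sub_le ⟨none, by simp⟩ fun i hi => ?_
    cases i with
    | none => simpa [translationMatrix_one, countNorm_zero] using hL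
    | some i => exact hF i (by simpa using hi)
  have hAg : countNorm 2 (A • g - g) ≤ 2 * L := by
    have : A • g - g = (1 - P) • (A • F - F) := by
      have hcomm : A * (1 - P) = (1 - P) * A :=
        ((Commute.one_right _).sub_right (commute_averageMatrix_subgroupAverage K _ _)).eq
      rw [smul_sub, hg, ← mul_smul, ← mul_smul, hcomm]
    rw [this]
    exact (countNorm_one_sub_subgroupAverage_smul_le K _).trans (by linarith)
  have hAkg : countNorm 2 (A ^ k • g - g) ≤ k * (2 * L) :=
    (countNorm_averageMatrix_pow_smul_sub_le _ _ k g).trans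
      (mul_le_mul_of_nonneg_left hAg k.cast_nonneg)
  have hgnorm : countNorm 2 g ≤ 4 * k * L := by
    have h1 := countNorm_sub_le (p := 2) (A ^ k • g) (A ^ k • g - g)
    rw [sub_sub_cancel] at h1
    have h2 := mul_le_mul_of_nonneg_right hk.le (countNorm_nonneg (p := 2) g)
    linarith
  -- `P • F` is fixed by translation by `h ∈ K`, so it drops out.
  have hdisp : translationMatrix h • F - F = translationMatrix h • g - g := by
    rw [hg, sub_smul, smul_sub, one_smul, ← mul_smul, translationMatrix_mul_subgroupAverage K hh]
    abel
  rw [hdisp]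
  refine (countNorm_sub_le _ _).trans ?_
  rw [countNorm_translationMatrix_smul]
  linarith

/-! ### Kazhdan pairs from regular representations. -/

section RegularRepresentation

variable {G : Type*} [Group G] {Q : Type*} [Group Q] [Fintype Q] [DecidableEq Q]

/-- The right regular representation of a finite quotient. -/
noncomputable def regularRep (f : G →* Q) :
    G →* (EuclideanSpace ℝ Q ≃ₗᵢ[ℝ] EuclideanSpace ℝ Q) where
  -- `piLpCongrLeft` precomposes with the inverse permutation; the inverse here makes the action `v
  -- (x * f g)`, matching `translationMatrix`.
  toFun g := LinearIsometryEquiv.piLpCongrLeft 2 ℝ ℝ (Equiv.mulRight (f g)⁻¹)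
  map_one' := by
    ext v x
    change v (x * (f 1)⁻¹⁻¹) = v x
    simp
  map_mul' g h := by
    ext v x
    change v (x * (f (g * h))⁻¹⁻¹) = v (x * (f g)⁻¹⁻¹ * (f h)⁻¹⁻¹)
    simp [mul_assoc]

variable [MeasurableSpace Q] [MeasurableSingletonClass Q]

theorem norm_toLp_eq_countNorm (v : Q → ℝ) : ‖WithLp.toLp 2 v‖ = countNorm 2 v := by
  rw [EuclideanSpace.norm_eq, countNorm_two_eq_sqrt]

theorem norm_regularRep_sub (f : G →* Q) (g : G) (v : Q → ℝ) :
    ‖regularRep f g (WithLp.toLp 2 v) - WithLp.toLp 2 v‖ =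
      countNorm 2 (translationMatrix (f g) • v - v) := by
  rw [← norm_toLp_eq_countNorm]
  congr 1
  ext x
  simp [regularRep, LinearIsometryEquiv.piLpCongrLeft_apply, translationMatrix]

end RegularRepresentation

theorem HasRelativePropertyT.exists_isKazhdanPair {G : Type u} [Group G] {S : Set G}
    (hSfin : S.Finite) (hS : Subgroup.closure S = ⊤) {H : Subgroup G}
    (hT : HasRelativePropertyT G (H : Set G)) {ι : Type*} (Q : ι → Type u) [∀ i, Group (Q i)]
    [∀ i, Fintype (Q i)] [∀ i, DecidableEq (Q i)] [∀ i, MeasurableSpace (Q i)]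
    [∀ i, MeasurableSingletonClass (Q i)] (f : ∀ i, G →* Q i) :
    ∃ ε : ℝ, 0 < ε ∧ ε ≤ 1 ∧ ∀ i, IsKazhdanPair hSfin.toFinset (f i) (H.map (f i)) ε := by
  obtain ⟨ε, hε, h⟩ := hT.exists_uniform hS (fun i => EuclideanSpace ℝ (Q i))
    (fun i => regularRep (f i)) (show (0 : ℝ) < 1 / 2 by norm_num)
  refine ⟨min ε 1, lt_min hε one_pos, min_le_right _ _, fun i v hv => ?_⟩
  rintro _ ⟨g, hg, rfl⟩
  rw [← norm_regularRep_sub, ← norm_toLp_eq_countNorm]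
  refine h i _ (fun s hs => ?_) g hg
  rw [norm_regularRep_sub, norm_toLp_eq_countNorm]
  exact (hv s (by simpa using hs)).trans
    (mul_le_mul_of_nonneg_right (min_le_left _ _) (countNorm_nonneg v))

/-! ### Balls in Cayley graphs of quotients. -/

section CayleyGraph

open scoped Pointwise

variable {G Q : Type*} [Group G] [Group Q]

theorem finite_insert_one_union_inv_pow {S : Set G} (hS : S.Finite) (R : ℕ) :
    ((insert 1 (S ∪ S⁻¹)) ^ R).Finite := by
  induction R with
  | zero => simp
  | succ R ih =>
    rw [pow_succ]
    exact ih.mul ((hS.union hS.inv).insert 1)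

theorem mulCayley_connected {T : Set Q} (hT : Subgroup.closure T = ⊤) :
    (SimpleGraph.mulCayley T).Connected := by
  have key (g : Q) : ∀ x, (SimpleGraph.mulCayley T).Reachable x (x * g) := by
    have hg : g ∈ Subgroup.closure T := hT ▸ Subgroup.mem_top g
    induction hg using Subgroup.closure_induction with
    | mem t ht =>
      intro x
      by_cases h : x = x * t
      · rw [← h]
      · exact SimpleGraph.Adj.reachable ((SimpleGraph.mulCayley_adj _ _ _).2 ⟨h, by simp [ht]⟩)
    | one => simp
    | mul a b _ _ ha hb => exact fun x => (ha x).trans (by simpa [mul_assoc] using hb (x * a))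
    | inv a _ ha => exact fun x => by simpa using (ha (x * a⁻¹)).symm
  exact ⟨fun x y => by simpa using key (x⁻¹ * y) x⟩

theorem mulCayley_dist_mul_le_one {T : Set Q} {t : Q} (ht : t ∈ T) (x : Q) :
    (SimpleGraph.mulCayley T).dist x (x * t) ≤ 1 := by
  by_cases h : x = x * t
  · rw [← h, SimpleGraph.dist_self]
    exact zero_le_one
  · exact (SimpleGraph.dist_eq_one_iff_adj.2
      ((SimpleGraph.mulCayley_adj _ _ _).2 ⟨h, by simp [ht]⟩)).le

theorem exists_mem_pow_of_walk (f : G →* Q) (S : Set G) {x y : Q}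
    (w : (SimpleGraph.mulCayley (f '' S)).Walk x y) (R : ℕ) (hR : w.length ≤ R) :
    ∃ b ∈ (insert 1 (S ∪ S⁻¹)) ^ R, y = x * f b := by
  induction w generalizing R with
  -- Walks shorter than `R` are padded by `1`, which is why `1` is inserted in the generating set.
  | nil => exact ⟨1, Set.one_mem_pow (Set.mem_insert _ _), by simp⟩
  | @cons a b c hadj w ih =>
    rw [SimpleGraph.Walk.length_cons] at hR
    obtain ⟨r, rfl⟩ := Nat.exists_eq_add_of_le' (Nat.one_le_of_lt hR)
    obtain ⟨b', hb', rfl⟩ := ih r (by omega)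
    obtain ⟨-, ⟨s, hs, hfs⟩ | ⟨s, hs, hfs⟩⟩ := (SimpleGraph.mulCayley_adj _ _ _).1 hadj
    · refine ⟨s * b', ?_, by simp [hfs, mul_assoc]⟩
      rw [pow_succ']
      exact Set.mul_mem_mul (by simp [hs]) hb'
    · refine ⟨s⁻¹ * b', ?_, by simp [hfs, mul_assoc]⟩
      rw [pow_succ']
      exact Set.mul_mem_mul (by simp [hs]) hb'

theorem exists_mem_pow_of_mulCayley_dist_le {f : G →* Q} (hf : Function.Surjective f) {S : Set G}
    (hS : Subgroup.closure S = ⊤) {x y : Q} {R : ℕ}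
    (h : (SimpleGraph.mulCayley (f '' S)).dist x y ≤ R) :
    ∃ b ∈ (insert 1 (S ∪ S⁻¹)) ^ R, y = x * f b := by
  have hcl : Subgroup.closure (f '' S) = ⊤ := by
    rw [← MonoidHom.map_closure, hS, Subgroup.map_top_of_surjective f hf]
  obtain ⟨w, hw⟩ := (mulCayley_connected hcl).exists_walk_length_eq_dist x y
  exact exists_mem_pow_of_walk f S w R (hw.trans_le h)

end CayleyGraph

/-- Elements of a finite set other than `1` survive in a deep enough quotient. -/
theorem exists_forall_notMem_of_iInf_eq_bot {G : Type*} [Group G] {N : ℕ → Subgroup G}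
    (hNanti : Antitone N) (hNinf : ⨅ n, N n = ⊥) {B : Set G} (hB : B.Finite) (h1 : (1 : G) ∉ B) :
    ∃ n, ∀ b ∈ B, b ∉ N n := by
  have hex (b : G) (hb : b ∈ B) : ∀ᶠ n in atTop, b ∉ N n := by
    have : b ∉ ⨅ n, N n := by
      rw [hNinf, Subgroup.mem_bot]
      rintro rfl
      exact h1 hb
    simp only [Subgroup.mem_iInf, not_forall] at this
    obtain ⟨n, hn⟩ := this
    exact eventually_atTop.2 ⟨n, fun m hm h => hn (hNanti hm h)⟩
  exact ((eventually_all_finite hB).2 hex).exists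

/-! ### Pointwise bounds and the final contradiction. -/

section Constants

variable {Ω V : Type*} [Fintype Ω] [MeasurableSpace Ω] [MeasurableSingletonClass Ω]
  [NormedAddCommGroup V] {F : Ω → V} {t : ℝ}

theorem countNorm_two_le_of_forall_le (ht : 0 ≤ t) (h : ∀ x, ‖F x‖ ≤ t) :
    countNorm 2 F ≤ t * √(Fintype.card Ω) := by
  refine (sq_le_sq₀ (countNorm_nonneg _) (by positivity)).1 ?_
  rw [countNorm_two_sq, mul_pow, Real.sq_sqrt (Nat.cast_nonneg _), mul_comm]
  refine (Finset.sum_le_sum fun x _ => pow_le_pow_left₀ (norm_nonneg _) (h x) 2).trans ?_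
  simp

theorem le_countNorm_two_of_forall_le (ht : 0 ≤ t) (h : ∀ x, t ≤ ‖F x‖) :
    t * √(Fintype.card Ω) ≤ countNorm 2 F := by
  refine (sq_le_sq₀ (by positivity) (countNorm_nonneg _)).1 ?_
  rw [countNorm_two_sq, mul_pow, Real.sq_sqrt (Nat.cast_nonneg _), mul_comm]
  refine le_trans ?_ (Finset.sum_le_sum fun x _ => pow_le_pow_left₀ ht (h x) 2)
  simp

end Constants

open scoped Pointwise in
theorem mainTheorem8 {G : Type u} [Group G] (S : Set G) (hSfin : S.Finite)
    (hSgen : Subgroup.closure S = ⊤)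
    (H : Subgroup G) (hHnormal : H.Normal) (hHinf : (H : Set G).Infinite)
    (hT : HasRelativePropertyT G (H : Set G))
    (N : ℕ → Subgroup G) [∀ n, (N n).Normal] (hNfin : ∀ n, (N n).FiniteIndex)
    (hNanti : Antitone N) (hNinf : ⨅ n, N n = ⊥)
    {𝕜 : Type*} [RCLike 𝕜] (X : Type*) [NormedAddCommGroup X] [NormedSpace 𝕜 X]
    [CompleteSpace X] (hX : IsUniformlyCurved 𝕜 X) :
    ¬ SeqCoarselyEmbeds (boxDist S N) X := by
  rintro ⟨φ, ρ, γ, hρ, -, hφ⟩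
  classical
  let : NormedSpace ℝ X := NormedSpace.restrictScalars ℝ 𝕜 X
  have : IsScalarTower ℝ 𝕜 X := IsScalarTower.of_algebraMap_smul fun _ _ => rfl
  let (n : ℕ) : Fintype (G ⧸ N n) := Fintype.ofFinite _
  let (n : ℕ) : MeasurableSpace (G ⧸ N n) := ⊤
  have (n : ℕ) : MeasurableSingletonClass (G ⧸ N n) := ⟨fun _ => trivial⟩
  obtain ⟨ε, hε, hε1, hK⟩ := hT.exists_isKazhdanPair hSfin hSgen (fun n => G ⧸ N n)
    fun n => QuotientGroup.mk' (N n)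
  obtain ⟨C, hC, hdisp⟩ := hX.exists_displacement_bound hε hε1 hSfin.toFinset.card
  -- `γ` need not be monotone, and a generator may become trivial in the quotient, so distance `0`
  -- is covered as well.
  let L : ℝ≥0 := max (γ 0) (γ 1)
  have hstep (n : ℕ) (s : G) (hs : s ∈ S) (x : G ⧸ N n) :
      ‖φ n (x * QuotientGroup.mk' (N n) s) - φ n x‖ ≤ L := by
    rw [← dist_eq_norm, dist_comm, ← coe_nndist, NNReal.coe_le_coe]
    refine (hφ n _ _).2.trans ?_
    have hd := mulCayley_dist_mul_le_one (Set.mem_image_of_mem (QuotientGroup.mk' (N n)) hs) x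
    unfold boxDist
    rcases Nat.le_one_iff_eq_zero_or_eq_one.1 hd with h | h
    · rw [h, Nat.cast_zero]
      exact le_max_left _ _
    · rw [h, Nat.cast_one]
      exact le_max_right _ _
  -- The target exceeds the displacement bound `C * L`, by `1` to make the contradiction strict.
  let t : ℝ≥0 := C.toNNReal * L + 1
  have ht : (t : ℝ) = C * L + 1 := by simp [t, hC.le]
  obtain ⟨r, hr⟩ := eventually_atTop.1 (hρ.eventually_ge_atTop t)
  have hBfin : ((insert 1 (S ∪ S⁻¹) : Set G) ^ ⌈r⌉₊).Finite :=
    finite_insert_one_union_inv_pow hSfin _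
  obtain ⟨h, hhH, hhB⟩ := hHinf.exists_notMem_finite hBfin
  -- As `h` lies outside the ball, no `b⁻¹ * h` with `b` in it is `1`; keeping these finitely many
  -- elements out of `N n` keeps the image of `h` outside the ball of the quotient.
  obtain ⟨n, hn⟩ := exists_forall_notMem_of_iInf_eq_bot hNanti hNinf
    (hBfin.image fun b => b⁻¹ * h) (by
      rintro ⟨b, hb, hb1⟩
      exact hhB (inv_mul_eq_one.1 hb1 ▸ hb))
  have hfar (x : G ⧸ N n) : (t : ℝ) ≤ ‖φ n (x * QuotientGroup.mk' (N n) h) - φ n x‖ := by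
    rw [← dist_eq_norm, dist_comm, ← coe_nndist, NNReal.coe_le_coe]
    refine le_trans (hr _ ?_) (hφ n _ _).1
    by_contra! hlt
    have hle : (SimpleGraph.mulCayley (QuotientGroup.mk' (N n) '' S)).dist x
        (x * QuotientGroup.mk' (N n) h) ≤ ⌈r⌉₊ := by
      have := hlt.le.trans (Nat.le_ceil r)
      unfold boxDist at this
      exact_mod_cast this
    obtain ⟨b, hb, hxb⟩ :=
      exists_mem_pow_of_mulCayley_dist_le (QuotientGroup.mk'_surjective (N n)) hSgen hle
    exact hn _ ⟨b, hb, rfl⟩ (QuotientGroup.eq.1 (mul_left_cancel hxb).symm)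
  have hcard : 0 < √(Fintype.card (G ⧸ N n) : ℝ) :=
    Real.sqrt_pos.2 (by exact_mod_cast Fintype.card_pos)
  have hupper := hdisp (G ⧸ N n) G hSfin.toFinset (QuotientGroup.mk' (N n))
    (H.map (QuotientGroup.mk' (N n))) rfl (hK n) (φ n) (L * √(Fintype.card (G ⧸ N n))) (by positivity)
    (fun s hs => countNorm_two_le_of_forall_le L.2 fun x => by
      rw [Pi.sub_apply, translationMatrix_smul]
      exact hstep n s (by simpa using hs) x)
    _ (Subgroup.mem_map_of_mem _ hhH)
  have hlower := le_countNorm_two_of_forall_le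
    (F := translationMatrix (QuotientGroup.mk' (N n) h) • φ n - φ n) t.2 fun x => by
      rw [Pi.sub_apply, translationMatrix_smul]
      exact hfar x
  change (t : ℝ) * _ ≤ _ at hlower
  rw [ht] at hlower
  linarith
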